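/- **Proposition.** Let $H\in(0,1]$ and let $B^H=(B^H_t)_{t\ge 0}$ be a fractional Brownian motion with Hurst index $H$ on a probability space $(\Omega,\mathcal F,\mathbb P)$, that is, a real-valued centered Gaussian process with covariance function $$\operatorname{Cov}(B^H_s,B^H_t)=\tfrac12\left(s^{2H}+t^{2H}-|s-t|^{2H}\right),\qquad s,t\ge 0.$$ Let $0\le T<\infty$ and assume that almost every path of $B^H$ is càdlàg on $[0,T]$ (in particular, this holds if the paths are continuous). Put $X^\star_T:=\sup_{0\le t\le T}|B^H_t|\in[0,\infty]$. Then $X^\star_T$ is a random variable (measurable up to modification on a null set), and for every $1\le p<\infty$, $$\mathbb E\left[(X^\star_T)^p\right]<\infty .$$ -/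

import Mathlib

open MeasureTheory ProbabilityTheory Filter Topology
open scoped NNReal ENNReal

/-- The covariance function `r_H(s, t) = (s^{2H} + t^{2H} - |s - t|^{2H}) / 2`. -/
noncomputable def fbmCov (H : ℝ) (s t : ℝ≥0) : ℝ :=
  ((s : ℝ) ^ (2 * H) + (t : ℝ) ^ (2 * H) - |(s : ℝ) - (t : ℝ)| ^ (2 * H)) / 2

/-- `B = (B_t)_{t ≥ 0}` is a fractional Brownian motion with Hurst index `H` under `P`: a centered
Gaussian process with covariance function `r_H`. -/
structure IsFractionalBrownianMotion {Ω : Type*} [MeasurableSpace Ω]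
    (H : ℝ) (B : ℝ≥0 → Ω → ℝ) (P : Measure Ω) : Prop where
  isGaussianProcess : IsGaussianProcess B P
  centered : ∀ t, ∫ ω, B t ω ∂P = 0
  covariance_eq : ∀ s t, cov[B s, B t; P] = fbmCov H s t

/-- The path `x` is càdlàg on `[0, T]`: right-continuous at each `t < T`, with a finite left limit
at each `t ≤ T` (at `t = 0` the latter condition is vacuous). -/
def IsCadlagOn (T : ℝ≥0) (x : ℝ≥0 → ℝ) : Prop :=
  (∀ t < T, ContinuousWithinAt x (Set.Ici t) t) ∧
    ∀ t ≤ T, ∃ l : ℝ, Tendsto x (𝓝[<] t) (𝓝 l)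

/-- The running maximum `sup_{0 ≤ t ≤ T} |B_t|`, as an extended nonnegative number. -/
noncomputable def runningMax {Ω : Type*} (B : ℝ≥0 → Ω → ℝ) (T : ℝ≥0) (ω : Ω) : ℝ≥0∞ :=
  ⨆ t ∈ Set.Icc 0 T, ENNReal.ofReal |B t ω|

/-!
The proof is a dyadic chaining argument. Right-continuity on `[0, T)` shows that the supremum over
`[0, T]` is the supremum over the countable set of dyadic points `T * (k / 2 ^ n)`, which contains
both endpoints (`iSup_enorm_eq_iSup_dyadic`); this gives measurability.

For the moments, fix `q ≥ 1` and put
`A = ∑' n, 2 ^ n * ∑ k < 2 ^ n, |Δ n k| ^ q`, where `Δ n k` is the `k`-th increment of the path on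
the dyadic grid of level `n`. Each `|Δ n k|` is at most `(2⁻ⁿ A) ^ (1 / q)`, and since a dyadic
point of level `n` is reached from `0` by at most one step of each level `≤ n`, the path is bounded
on the dyadic points by `|x 0| + c * A ^ (1 / q)` with `c` the sum of a geometric series
(`enorm_dyadic_le_chainingSum`). A centered Gaussian increment of variance `|s - t| ^ (2 H)` has
`q`-th absolute moment `C_q * |s - t| ^ (q H)`, so that for `q H ≥ 3` the terms of `E[A]` are of
order `2 ^ n * 2 ^ n * 2 ^ (-3 n)` and `E[A]` is finite.
-/

/-! ### Dyadic points and chaining -/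

/-- The `k`-th point `T * k / 2 ^ n` of the dyadic grid of level `n` on `[0, T]`. -/
noncomputable def dyadicPoint (T : ℝ≥0) (n k : ℕ) : ℝ≥0 := T * (k / 2 ^ n)

lemma dyadicPoint_zero_right (T : ℝ≥0) (n : ℕ) : dyadicPoint T n 0 = 0 := by
  simp [dyadicPoint]

lemma dyadicPoint_zero_one (T : ℝ≥0) : dyadicPoint T 0 1 = T := by
  simp [dyadicPoint]

lemma dyadicPoint_succ_two_mul (T : ℝ≥0) (n k : ℕ) :
    dyadicPoint T (n + 1) (2 * k) = dyadicPoint T n k := by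
  unfold dyadicPoint
  congr 1
  push_cast
  rw [pow_succ]
  field_simp

lemma dyadicPoint_le (T : ℝ≥0) {n k : ℕ} (hk : k ≤ 2 ^ n) : dyadicPoint T n k ≤ T := by
  unfold dyadicPoint
  refine mul_le_of_le_one_right' ?_
  rw [div_le_one (by positivity)]
  exact_mod_cast hk

lemma edist_dyadicPoint_succ (T : ℝ≥0) (n k : ℕ) :
    edist (dyadicPoint T n (k + 1)) (dyadicPoint T n k) = T * 2⁻¹ ^ n := by
  have h : nndist (dyadicPoint T n (k + 1)) (dyadicPoint T n k) = T * 2⁻¹ ^ n := by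
    rw [← NNReal.coe_inj, coe_nndist, NNReal.dist_eq]
    have : ((dyadicPoint T n (k + 1) : ℝ≥0) : ℝ) - dyadicPoint T n k = T * 2⁻¹ ^ n := by
      simp only [dyadicPoint]
      push_cast
      rw [inv_pow]
      field_simp
      ring
    rw [this, abs_of_nonneg (by positivity)]
    push_cast
    rfl
  rw [edist_nndist, h]
  push_cast
  rfl

/-- If the dyadic increments of level `n` are bounded by `a n`, then the value at a dyadic point is
reached from the value at `0` by using at most one increment of each level. -/
lemma enorm_dyadicPoint_le_add_sum {x : ℝ≥0 → ℝ} {T : ℝ≥0} {a : ℕ → ℝ≥0∞}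
    (ha : ∀ n, ∀ k < 2 ^ n, ‖x (dyadicPoint T n (k + 1)) - x (dyadicPoint T n k)‖ₑ ≤ a n)
    (n k : ℕ) (hk : k ≤ 2 ^ n) :
    ‖x (dyadicPoint T n k)‖ₑ ≤ ‖x 0‖ₑ + ∑ i ∈ Finset.range (n + 1), a i := by
  have step : ∀ n k, k < 2 ^ n → ‖x (dyadicPoint T n (k + 1))‖ₑ ≤
      ‖x (dyadicPoint T n k)‖ₑ + a n := fun n k hk => by
    calc ‖x (dyadicPoint T n (k + 1))‖ₑ
        = ‖x (dyadicPoint T n k)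
            + (x (dyadicPoint T n (k + 1)) - x (dyadicPoint T n k))‖ₑ := by
          rw [add_sub_cancel]
      _ ≤ _ := (enorm_add_le _ _).trans (by gcongr; exact ha n k hk)
  induction n generalizing k with
  | zero =>
    obtain rfl | rfl : k = 0 ∨ k = 1 := by simp at hk; omega
    · simp [dyadicPoint_zero_right]
    · simpa [dyadicPoint_zero_right] using step 0 0 (by simp)
  | succ n ih =>
    rw [Finset.sum_range_succ, ← add_assoc]
    rw [pow_succ] at hk
    obtain ⟨j, rfl | rfl⟩ := k.even_or_odd'
    · rw [dyadicPoint_succ_two_mul]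
      exact (ih j (by omega)).trans le_self_add
    · refine (step (n + 1) (2 * j) (by rw [pow_succ]; omega)).trans ?_
      rw [dyadicPoint_succ_two_mul]
      gcongr
      exact ih j (by omega)

/-- The weighted sum `∑ n, 2 ^ n * ∑ k < 2 ^ n, |Δ n k| ^ q` over all dyadic increments `Δ n k` of
the path `x` on `[0, T]`. -/
noncomputable def chainingSum (q : ℝ) (T : ℝ≥0) (x : ℝ≥0 → ℝ) : ℝ≥0∞ :=
  ∑' n, 2 ^ n * ∑ k ∈ Finset.range (2 ^ n),
    ‖x (dyadicPoint T n (k + 1)) - x (dyadicPoint T n k)‖ₑ ^ q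

/-- The constant `∑ n, 2 ^ (- n / q)` of the chaining bound. -/
noncomputable def chainingConst (q : ℝ) : ℝ≥0∞ := ∑' n : ℕ, (2⁻¹ ^ q⁻¹) ^ n

lemma chainingConst_lt_top {q : ℝ} (hq : 0 < q) : chainingConst q < ∞ := by
  rw [chainingConst, ENNReal.tsum_geometric, ENNReal.inv_lt_top, tsub_pos_iff_lt]
  exact ENNReal.rpow_lt_one (by simp) (by positivity)

lemma enorm_dyadic_le_chainingSum {q : ℝ} (hq : 0 < q) (T : ℝ≥0) (x : ℝ≥0 → ℝ) {n k : ℕ}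
    (hk : k ≤ 2 ^ n) :
    ‖x (dyadicPoint T n k)‖ₑ ≤ ‖x 0‖ₑ + chainingConst q * chainingSum q T x ^ q⁻¹ := by
  refine (enorm_dyadicPoint_le_add_sum
    (a := fun n => (2⁻¹ ^ q⁻¹) ^ n * chainingSum q T x ^ q⁻¹) ?_ n k hk).trans ?_
  · intro n k hk
    have h : 2 ^ n * ‖x (dyadicPoint T n (k + 1)) - x (dyadicPoint T n k)‖ₑ ^ q ≤
        chainingSum q T x := by
      refine le_trans ?_ (ENNReal.le_tsum n)
      gcongr
      exact Finset.single_le_sum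
        (f := fun k => ‖x (dyadicPoint T n (k + 1)) - x (dyadicPoint T n k)‖ₑ ^ q)
        (fun _ _ => zero_le) (Finset.mem_range.2 hk)
    have h' : ‖x (dyadicPoint T n (k + 1)) - x (dyadicPoint T n k)‖ₑ ^ q ≤
        2⁻¹ ^ n * chainingSum q T x := by
      rw [← ENNReal.inv_pow, mul_comm, ← div_eq_mul_inv,
        ENNReal.le_div_iff_mul_le (by simp) (by simp), mul_comm]
      exact h
    rw [← ENNReal.rpow_natCast, ← ENNReal.rpow_mul, mul_comm q⁻¹, ENNReal.rpow_mul,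
      ENNReal.rpow_natCast, ← ENNReal.mul_rpow_of_nonneg _ _ (by positivity)]
    exact (ENNReal.le_rpow_inv_iff hq).2 h'
  · gcongr
    rw [← Finset.sum_mul]
    gcongr
    exact ENNReal.sum_le_tsum _

/-! ### The supremum over an interval as a countable supremum -/

/-- The dyadic points `T * ⌈2 ^ n t / T⌉ / 2 ^ n` tend to `t` from the right, so a right-continuous
path is bounded on `[0, T]` by any bound on its dyadic values. -/
lemma enorm_le_of_forall_dyadicPoint {x : ℝ≥0 → ℝ} {T : ℝ≥0}
    (hx : ∀ t < T, ContinuousWithinAt x (Set.Ici t) t) {c : ℝ≥0∞}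
    (hc : ∀ n, ∀ k ≤ 2 ^ n, ‖x (dyadicPoint T n k)‖ₑ ≤ c) {t : ℝ≥0} (ht : t ≤ T) :
    ‖x t‖ₑ ≤ c := by
  obtain rfl | htT := ht.eq_or_lt
  · simpa [dyadicPoint_zero_one] using hc 0 1 (by simp)
  have hT : 0 < T := bot_le.trans_lt htT
  have hT' : (0 : ℝ) < T := hT
  have hceil (n : ℕ) : t / T * 2 ^ n ≤ ⌈t / T * 2 ^ n⌉₊ := Nat.le_ceil _
  have hlow (n : ℕ) : t ≤ dyadicPoint T n ⌈t / T * 2 ^ n⌉₊ := by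
    calc t = T * (t / T * 2 ^ n / 2 ^ n) := by field_simp
      _ ≤ _ := by
        unfold dyadicPoint
        gcongr
        exact hceil n
  have hupp (n : ℕ) : dyadicPoint T n ⌈t / T * 2 ^ n⌉₊ ≤ t + T * 2⁻¹ ^ n := by
    calc dyadicPoint T n ⌈t / T * 2 ^ n⌉₊ ≤ T * ((t / T * 2 ^ n + 1) / 2 ^ n) := by
          unfold dyadicPoint
          gcongr
          exact (Nat.ceil_lt_add_one zero_le).le
      _ = _ := by
        rw [inv_pow]
        field_simp
  have hk (n : ℕ) : ⌈t / T * 2 ^ n⌉₊ ≤ 2 ^ n := by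
    rw [Nat.ceil_le]
    push_cast
    exact mul_le_of_le_one_left' ((div_le_one hT).2 ht)
  have hlim : Tendsto (fun n => dyadicPoint T n ⌈t / T * 2 ^ n⌉₊) atTop (𝓝 t) := by
    refine tendsto_of_tendsto_of_tendsto_of_le_of_le tendsto_const_nhds ?_ hlow hupp
    have := (NNReal.tendsto_pow_atTop_nhds_zero_of_lt_one (r := 2⁻¹)
      (inv_lt_one_of_one_lt₀ one_lt_two)).const_mul T |>.const_add t
    simpa using this
  have hlim' : Tendsto (fun n => dyadicPoint T n ⌈t / T * 2 ^ n⌉₊) atTop (𝓝[≥] t) :=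
    tendsto_nhdsWithin_iff.2 ⟨hlim, Eventually.of_forall hlow⟩
  exact le_of_tendsto' (((hx t htT).tendsto.comp hlim').enorm) fun n => hc n _ (hk n)

lemma iSup_enorm_eq_iSup_dyadic {x : ℝ≥0 → ℝ} {T : ℝ≥0}
    (hx : ∀ t < T, ContinuousWithinAt x (Set.Ici t) t) :
    ⨆ t ∈ Set.Icc 0 T, ‖x t‖ₑ = ⨆ n, ⨆ k : Fin (2 ^ n + 1), ‖x (dyadicPoint T n k)‖ₑ := by
  refine le_antisymm (iSup₂_le fun t ht => ?_) (iSup₂_le fun n k => ?_)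
  · refine enorm_le_of_forall_dyadicPoint hx (fun n k hk => ?_) ht.2
    exact le_iSup₂_of_le n ⟨k, by omega⟩ le_rfl
  · exact le_iSup₂_of_le (f := fun t (_ : t ∈ Set.Icc 0 T) => ‖x t‖ₑ) _
      ⟨zero_le, dyadicPoint_le T (by omega)⟩ le_rfl

/-! ### Maximal inequality -/

lemma runningMax_eq_iSup_enorm {Ω : Type*} (B : ℝ≥0 → Ω → ℝ) (T : ℝ≥0) (ω : Ω) :
    runningMax B T ω = ⨆ t ∈ Set.Icc 0 T, ‖B t ω‖ₑ := by
  simp_rw [runningMax, ← Real.norm_eq_abs, ofReal_norm]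

section Maximal

variable {Ω : Type*} [MeasurableSpace Ω] {P : Measure Ω} {B : ℝ≥0 → Ω → ℝ} {T : ℝ≥0}

lemma aemeasurable_runningMax (hB : ∀ t, AEMeasurable (B t) P)
    (hpath : ∀ᵐ ω ∂P, ∀ t < T, ContinuousWithinAt (fun t => B t ω) (Set.Ici t) t) :
    AEMeasurable (runningMax B T) P := by
  have h : AEMeasurable (fun ω => ⨆ n, ⨆ k : Fin (2 ^ n + 1), ‖B (dyadicPoint T n k) ω‖ₑ) P :=
    .iSup fun n => .iSup fun k => (hB _).enorm
  refine h.congr ?_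
  filter_upwards [hpath] with ω hω
  rw [runningMax_eq_iSup_enorm, iSup_enorm_eq_iSup_dyadic hω]

/-- Level `n` carries the weight `2 ^ n` and `2 ^ n` increments, so a `q`-th moment bound of third
order in the mesh `2⁻ⁿ` leaves a convergent geometric series. -/
lemma lintegral_chainingSum_lt_top {q : ℝ} {C : ℝ≥0∞} (hC : C ≠ ∞)
    (hB : ∀ t, AEMeasurable (B t) P)
    (hinc : ∀ n, ∀ k < 2 ^ n, ∫⁻ ω, ‖B (dyadicPoint T n (k + 1)) ω -
      B (dyadicPoint T n k) ω‖ₑ ^ q ∂P ≤ C * (2⁻¹ ^ n) ^ 3) :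
    ∫⁻ ω, chainingSum q T (fun t => B t ω) ∂P < ∞ := by
  have hmeas (n k : ℕ) : AEMeasurable (fun ω => ‖B (dyadicPoint T n (k + 1)) ω -
      B (dyadicPoint T n k) ω‖ₑ ^ q) P := ((hB _).sub (hB _)).enorm.pow_const q
  have hterm (n : ℕ) : ∫⁻ ω, 2 ^ n * ∑ k ∈ Finset.range (2 ^ n),
      ‖B (dyadicPoint T n (k + 1)) ω - B (dyadicPoint T n k) ω‖ₑ ^ q ∂P ≤ C * 2⁻¹ ^ n := by
    rw [lintegral_const_mul' _ _ (by simp), lintegral_finsetSum' _ fun k _ => hmeas n k]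
    calc 2 ^ n * ∑ k ∈ Finset.range (2 ^ n), ∫⁻ ω, ‖B (dyadicPoint T n (k + 1)) ω -
            B (dyadicPoint T n k) ω‖ₑ ^ q ∂P
        ≤ 2 ^ n * ∑ k ∈ Finset.range (2 ^ n), C * (2⁻¹ ^ n) ^ 3 := by
          gcongr with k hk
          exact hinc n k (Finset.mem_range.1 hk)
      _ = C * ((2 * 2⁻¹) ^ n * (2 * 2⁻¹) ^ n * 2⁻¹ ^ n) := by
          simp only [Finset.sum_const, Finset.card_range, nsmul_eq_mul, mul_pow]
          push_cast
          ring
      _ = C * 2⁻¹ ^ n := by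
          rw [ENNReal.mul_inv_cancel two_ne_zero (by simp)]
          simp
  unfold chainingSum
  rw [lintegral_tsum fun n => ((Finset.aemeasurable_fun_sum _ fun k _ => hmeas n k).const_mul _)]
  calc _ ≤ ∑' n : ℕ, C * 2⁻¹ ^ n := ENNReal.tsum_le_tsum hterm
    _ = C * 2 := by rw [ENNReal.tsum_mul_left, ENNReal.tsum_geometric_two]
    _ < ∞ := ENNReal.mul_lt_top hC.lt_top (by simp)

lemma lintegral_runningMax_rpow_lt_top {q : ℝ} (hq : 1 ≤ q) {C : ℝ≥0∞} (hC : C ≠ ∞)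
    (hB : ∀ t, AEMeasurable (B t) P)
    (hpath : ∀ᵐ ω ∂P, ∀ t < T, ContinuousWithinAt (fun t => B t ω) (Set.Ici t) t)
    (h0 : ∫⁻ ω, ‖B 0 ω‖ₑ ^ q ∂P < ∞)
    (hinc : ∀ n, ∀ k < 2 ^ n, ∫⁻ ω, ‖B (dyadicPoint T n (k + 1)) ω -
      B (dyadicPoint T n k) ω‖ₑ ^ q ∂P ≤ C * (2⁻¹ ^ n) ^ 3) :
    ∫⁻ ω, runningMax B T ω ^ q ∂P < ∞ := by
  have hq0 : 0 < q := by linarith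
  have hle : ∀ᵐ ω ∂P, runningMax B T ω ^ q ≤ 2 ^ (q - 1) *
      (‖B 0 ω‖ₑ ^ q + chainingConst q ^ q * chainingSum q T (fun t => B t ω)) := by
    filter_upwards [hpath] with ω hω
    have h : runningMax B T ω ≤
        ‖B 0 ω‖ₑ + chainingConst q * chainingSum q T (fun t => B t ω) ^ q⁻¹ := by
      rw [runningMax_eq_iSup_enorm]
      exact iSup₂_le fun t ht => enorm_le_of_forall_dyadicPoint hω
        (fun n k hk => enorm_dyadic_le_chainingSum hq0 T (fun t => B t ω) hk) ht.2
    calc _ ≤ (‖B 0 ω‖ₑ + chainingConst q * chainingSum q T (fun t => B t ω) ^ q⁻¹) ^ q := by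
          gcongr
      _ ≤ _ := ENNReal.rpow_add_le_mul_rpow_add_rpow _ _ hq
      _ = _ := by
          rw [ENNReal.mul_rpow_of_nonneg _ _ hq0.le, ENNReal.rpow_inv_rpow hq0.ne']
  refine (lintegral_mono_ae hle).trans_lt ?_
  rw [lintegral_const_mul' _ _ (ENNReal.rpow_lt_top_of_nonneg (by linarith) (by simp)).ne,
    lintegral_add_left' ((hB 0).enorm.pow_const q),
    lintegral_const_mul' _ _ (by simp [hq0.le, (chainingConst_lt_top hq0).ne])]
  have hc : chainingConst q ^ q < ∞ :=
    ENNReal.rpow_lt_top_of_nonneg hq0.le (chainingConst_lt_top hq0).ne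
  exact ENNReal.mul_lt_top (ENNReal.rpow_lt_top_of_nonneg (by linarith) (by simp))
    (ENNReal.add_lt_top.2 ⟨h0, ENNReal.mul_lt_top hc (lintegral_chainingSum_lt_top hC hB hinc)⟩)

end Maximal

/-! ### Moments of Gaussian increments -/

section Gaussian

variable {Ω : Type*} [MeasurableSpace Ω] {P : Measure Ω}

/-- Scaling: a centered Gaussian variable is distributed as its standard deviation times a standard
Gaussian. -/
lemma ProbabilityTheory.HasGaussianLaw.lintegral_enorm_rpow {X : Ω → ℝ} (hX : HasGaussianLaw X P)
    (h0 : ∫ ω, X ω ∂P = 0) {q : ℝ} (hq : 0 ≤ q) :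
    ∫⁻ ω, ‖X ω‖ₑ ^ q ∂P =
      ENNReal.ofReal (√Var[X; P]) ^ q * ∫⁻ x, ‖x‖ₑ ^ q ∂(gaussianReal 0 1) := by
  have hmap : P.map X = (gaussianReal 0 1).map (√Var[X; P] * ·) := by
    rw [hX.map_eq_gaussianReal, gaussianReal_map_const_mul, h0]
    congr 1
    · simp
    · ext
      simp [Real.sq_sqrt, variance_nonneg]
  have hmeas : Measurable fun x : ℝ => ‖x‖ₑ ^ q := by fun_prop
  rw [← lintegral_map' hmeas.aemeasurable hX.aemeasurable, hmap,
    lintegral_map hmeas (by fun_prop)]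
  simp_rw [enorm_mul, ENNReal.mul_rpow_of_nonneg _ _ hq]
  rw [lintegral_const_mul _ hmeas, Real.enorm_of_nonneg (Real.sqrt_nonneg _)]

lemma ProbabilityTheory.HasGaussianLaw.lintegral_enorm_rpow_lt_top {X : Ω → ℝ}
    (hX : HasGaussianLaw X P) {q : ℝ} (hq : 0 < q) : ∫⁻ ω, ‖X ω‖ₑ ^ q ∂P < ∞ := by
  have := lintegral_rpow_enorm_lt_top_of_eLpNorm_lt_top (by simpa using hq) (by simp)
    (hX.memLp (p := ENNReal.ofReal q) (by simp)).eLpNorm_lt_top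
  rwa [ENNReal.toReal_ofReal hq.le] at this

variable {H : ℝ} {B : ℝ≥0 → Ω → ℝ}

lemma IsFractionalBrownianMotion.variance_sub (hB : IsFractionalBrownianMotion H B P) (hH : H ≠ 0)
    (s t : ℝ≥0) : Var[B s - B t; P] = |(s : ℝ) - t| ^ (2 * H) := by
  have := hB.isGaussianProcess.isProbabilityMeasure
  have hL (t) := (hB.isGaussianProcess.hasGaussianLaw_eval t).memLp_two
  have hm (t) := hB.isGaussianProcess.aemeasurable t
  rw [ProbabilityTheory.variance_sub (hL s) (hL t), ← covariance_self (hm s),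
    ← covariance_self (hm t), hB.covariance_eq, hB.covariance_eq, hB.covariance_eq]
  simp only [fbmCov, sub_self, abs_zero, Real.zero_rpow (mul_ne_zero two_ne_zero hH)]
  ring

lemma IsFractionalBrownianMotion.lintegral_enorm_sub_rpow (hB : IsFractionalBrownianMotion H B P)
    (hH : 0 < H) {q : ℝ} (hq : 0 ≤ q) (s t : ℝ≥0) :
    ∫⁻ ω, ‖B s ω - B t ω‖ₑ ^ q ∂P =
      edist s t ^ (q * H) * ∫⁻ x, ‖x‖ₑ ^ q ∂(gaussianReal 0 1) := by
  have hL (t) := (hB.isGaussianProcess.hasGaussianLaw_eval t).integrable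
  have hmean : ∫ ω, (B s - B t) ω ∂P = 0 := by
    simp only [Pi.sub_apply]
    rw [integral_sub (hL s) (hL t), hB.centered, hB.centered, sub_zero]
  have h := (hB.isGaussianProcess.hasGaussianLaw_sub (s := s) (t := t)).lintegral_enorm_rpow
    hmean hq
  simp only [Pi.sub_apply] at h
  rw [h, hB.variance_sub hH.ne']
  congr 1
  rw [mul_comm 2 H, Real.rpow_mul (abs_nonneg _), Real.rpow_two,
    Real.sqrt_sq (by positivity), ← ENNReal.ofReal_rpow_of_nonneg (abs_nonneg _) hH.le,
    ← ENNReal.rpow_mul, mul_comm H, edist_dist, NNReal.dist_eq]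

end Gaussian

/-! ### Fractional Brownian motion -/

theorem mainTheorem7 {Ω : Type*} [MeasurableSpace Ω] (P : Measure Ω) [IsProbabilityMeasure P]
    (H : ℝ) (hH : H ∈ Set.Ioc (0 : ℝ) 1)
    (B : ℝ≥0 → Ω → ℝ) (hB : IsFractionalBrownianMotion H B P)
    (T : ℝ≥0) (hpath : ∀ᵐ ω ∂P, IsCadlagOn T (fun t => B t ω))
    (p : ℝ) (hp : 1 ≤ p) :
    AEMeasurable (runningMax B T) P ∧ ∫⁻ ω, (runningMax B T ω) ^ p ∂P < ∞ := by
  have hm (t) := hB.isGaussianProcess.aemeasurable t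
  have hright : ∀ᵐ ω ∂P, ∀ t < T, ContinuousWithinAt (fun t => B t ω) (Set.Ici t) t :=
    hpath.mono fun ω hω => hω.1
  refine ⟨aemeasurable_runningMax hm hright, ?_⟩
  -- `q * H ≥ 3` makes the dyadic increments summable; `p ≤ q` suffices as `P` is finite.
  set q := max p (3 / H)
  have hpq : p ≤ q := le_max_left _ _
  have hqH : 3 ≤ q * H := (div_le_iff₀ hH.1).1 (le_max_right _ _)
  have hq0 : 0 < q := by linarith
  set M := ∫⁻ x, ‖x‖ₑ ^ q ∂(gaussianReal 0 1)
  have hM : M < ∞ := IsGaussian.hasGaussianLaw_id.lintegral_enorm_rpow_lt_top hq0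
  have hT : (T : ℝ≥0∞) ^ (q * H) < ∞ := ENNReal.rpow_lt_top_of_nonneg (by linarith) (by simp)
  have hmax : ∫⁻ ω, runningMax B T ω ^ q ∂P < ∞ := by
    refine lintegral_runningMax_rpow_lt_top (hp.trans hpq)
      (ENNReal.mul_lt_top hT hM).ne hm hright
      ((hB.isGaussianProcess.hasGaussianLaw_eval 0).lintegral_enorm_rpow_lt_top hq0)
      fun n k _ => ?_
    rw [hB.lintegral_enorm_sub_rpow hH.1 hq0.le, edist_dyadicPoint_succ,
      ENNReal.mul_rpow_of_nonneg _ _ (by linarith), mul_right_comm]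
    gcongr
    rw [← ENNReal.rpow_ofNat]
    exact ENNReal.rpow_le_rpow_of_exponent_ge (pow_le_one₀ zero_le (by simp)) hqH
  calc ∫⁻ ω, runningMax B T ω ^ p ∂P ≤ ∫⁻ ω, 1 + runningMax B T ω ^ q ∂P := by
        refine lintegral_mono fun ω => ?_
        obtain h | h := le_total (runningMax B T ω) 1
        · exact (ENNReal.rpow_le_one h (by linarith)).trans le_self_add
        · exact (ENNReal.rpow_le_rpow_of_exponent_le h hpq).trans le_add_self
    _ = 1 + ∫⁻ ω, runningMax B T ω ^ q ∂P := by
        rw [lintegral_add_left measurable_const]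
        simp
    _ < ∞ := ENNReal.add_lt_top.2 ⟨by simp, hmax⟩
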